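/- A Mealy automaton $\mathcal M=(A,Q,\lambda,\rho)$ consists of a finite alphabet $A$, a finite state set $Q$, an output map $\lambda\colon Q\times A\to A$ and a transition map $\rho\colon Q\times A\to Q$. It is *invertible* if $a\mapsto\lambda(q,a)$ is a bijection of $A$ for every $q\in Q$; *reversible* if $q\mapsto\rho(q,a)$ is a bijection of $Q$ for every $a\in A$; and *bireversible* if it is invertible, reversible, and $(q,a)\mapsto(\lambda(q,a),\rho(q,a))$ is a bijection $Q\times A\to A\times Q$. If $\mathcal M$ is invertible, each state $q$ defines a bijection $\lambda_q$ of the set $A^*$ of finite words by $\lambda_q(aw)=\lambda(q,a)\,\lambda_{\rho(q,a)}(w)$ (and $\lambda_q$ fixes the empty word), and the group generated by $\mathcal M$ is the quotient of the free group $F_Q$ by the kernel of the homomorphism $F_Q\to\mathrm{Sym}(A^*)$, $q\mapsto\lambda_q$. Let $\mathbf{Bir}$ be the class of groups isomorphic to the group generated by some bireversible automaton, and $\mathbf{InvRev}$ the class of groups isomorphic to the group generated by some invertible and reversible automaton. **Corollary E.** $\mathbf{Bir}\subsetneq\mathbf{InvRev}$. Moreover, for every integer $m\ge 2$, the Baumslag–Solitar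 group $BS(1,m)=\langle a,t\mid tat^{-1}=a^m\rangle$ belongs to $\mathbf{InvRev}$, has a distorted cyclic subgroup, and does not belong to $\mathbf{Bir}$. Here a finitely generated subgroup $H$ of a finitely generated group $G$ is *undistorted* if, for finite generating sets $S$ of $G$ and $T$ of $H$, there is a constant $C>0$ with $|h|_T\le C|h|_S$ for all $h\in H$, where $|\cdot|_S,|\cdot|_T$ are the word lengths (this does not depend on $S$ and $T$); otherwise it is *distorted*. -/

import Mathlib

universe u v

/-- A Mealy automaton with alphabet `A` and state set `Q`, both finite.  Reading the letter `a` in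
the state `q`, it outputs the letter `output q a` and moves to the state `transition q a`. -/
structure MealyAutomaton (A : Type u) (Q : Type v) where
  /-- the output map `(q, a) ↦ λ(q, a)` -/
  output : Q → A → A
  /-- the transition map `(q, a) ↦ ρ(q, a)` -/
  transition : Q → A → Q
  finite_alphabet : Finite A
  finite_states : Finite Q

namespace MealyAutomaton

variable {A : Type u} {Q : Type v}

/-- For every state `q`, the map `a ↦ λ(q, a)` is a bijection of the alphabet. -/
def IsInvertible (M : MealyAutomaton A Q) : Prop :=
  ∀ q : Q, Function.Bijective fun a : A => M.output q a

/-- For every letter `a`, the map `q ↦ ρ(q, a)` is a bijection of the state set. -/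
def IsReversible (M : MealyAutomaton A Q) : Prop :=
  ∀ a : A, Function.Bijective fun q : Q => M.transition q a

/-- Invertible, reversible, and `(q, a) ↦ (λ(q, a), ρ(q, a))` is a bijection `Q × A → A × Q`. -/
def IsBireversible (M : MealyAutomaton A Q) : Prop :=
  M.IsInvertible ∧ M.IsReversible ∧
    Function.Bijective fun p : Q × A => ((M.output p.1 p.2, M.transition p.1 p.2) : A × Q)

/-- The extension of the output map to words:
`λ_q(a w) = λ_q(a) λ_{ρ(q, a)}(w)`. -/
def outputWord (M : MealyAutomaton A Q) : Q → List A → List A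
  | _, [] => []
  | q, a :: w => M.output q a :: M.outputWord (M.transition q a) w

theorem outputWord_bijective (M : MealyAutomaton A Q) (h : M.IsInvertible) (q : Q) :
    Function.Bijective (M.outputWord q) := by
  constructor
  · intro v
    induction v generalizing q with
    | nil =>
      intro w hw
      cases w with
      | nil => rfl
      | cons b w => simp [outputWord] at hw
    | cons a v ih =>
      intro w hw
      cases w with
      | nil => simp [outputWord] at hw
      | cons b w =>
        simp only [outputWord, List.cons.injEq] at hw
        obtain ⟨h1, h2⟩ := hw
        obtain rfl : a = b := (h q).1 h1
        rw [ih _ h2]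
  · intro w
    induction w generalizing q with
    | nil => exact ⟨[], rfl⟩
    | cons b w ih =>
      obtain ⟨a, ha⟩ := (h q).2 b
      obtain ⟨v, hv⟩ := ih (M.transition q a)
      refine ⟨a :: v, ?_⟩
      simp only at ha
      simp only [outputWord, ha, hv]

/-- The permutation of the set of words over the alphabet given by a state of an invertible
automaton. -/
noncomputable def statePerm (M : MealyAutomaton A Q) (h : M.IsInvertible) (q : Q) :
    Equiv.Perm (List A) :=
  Equiv.ofBijective (M.outputWord q) (M.outputWord_bijective h q)

/-- The homomorphism from the free group on the states to the permutations of the words (with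
composition from right to left). -/
noncomputable def action (M : MealyAutomaton A Q) (h : M.IsInvertible) :
    FreeGroup Q →* Equiv.Perm (List A) :=
  FreeGroup.lift (M.statePerm h)

/-- The group generated by an invertible automaton. -/
abbrev generatedGroup (M : MealyAutomaton A Q) (h : M.IsInvertible) : Type v :=
  FreeGroup Q ⧸ (M.action h).ker

end MealyAutomaton

/-- `G` is isomorphic to the group generated by some bireversible automaton.  (Alphabet and state
set are finite, so it is no restriction to take them in `Type`.) -/
def IsBireversibleGroup (G : Type u) [Group G] : Prop :=
  ∃ (A Q : Type) (M : MealyAutomaton A Q) (h : M.IsBireversible),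
    Nonempty (G ≃* M.generatedGroup h.1)

/-- `G` is isomorphic to the group generated by some invertible and reversible automaton. -/
def IsInvertibleReversibleGroup (G : Type u) [Group G] : Prop :=
  ∃ (A Q : Type) (M : MealyAutomaton A Q) (h : M.IsInvertible ∧ M.IsReversible),
    Nonempty (G ≃* M.generatedGroup h.1)

/-- The class of groups generated by bireversible automata. -/
def Bir : Set GrpCat.{u} := {G | IsBireversibleGroup G}

/-- The class of groups generated by invertible and reversible automata. -/
def InvRev : Set GrpCat.{u} := {G | IsInvertibleReversibleGroup G}

/-- The Baumslag-Solitar group `BS(k, m) = ⟨a, t | t a^k t⁻¹ = a^m⟩`, with `a` and `t` the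
generators of index `0` and `1`. -/
abbrev BaumslagSolitar (k m : ℤ) : Type :=
  PresentedGroup ({FreeGroup.of 1 * FreeGroup.of 0 ^ k * (FreeGroup.of 1)⁻¹ *
    (FreeGroup.of 0 ^ m)⁻¹} : Set (FreeGroup (Fin 2)))

/-- The word length of `g` with respect to `S`: the least length of a word in the elements of `S`
and their inverses that represents `g`.  It is only used for generating sets `S`. -/
noncomputable def wordLength {G : Type u} [Group G] (S : Set G) (g : G) : ℕ :=
  sInf {n | ∃ l : List G, (∀ x ∈ l, x ∈ S ∨ x⁻¹ ∈ S) ∧ l.prod = g ∧ l.length = n}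

/-- `H` is undistorted in `G`: for some finite generating sets `S` of `G` and `T` of `H` there is a
constant `C > 0` with `|h|_T ≤ C |h|_S` for all `h` in `H`. -/
def Subgroup.IsUndistorted {G : Type u} [Group G] (H : Subgroup G) : Prop :=
  ∃ (S : Set G) (T : Set H), S.Finite ∧ T.Finite ∧
    Subgroup.closure S = ⊤ ∧ Subgroup.closure T = ⊤ ∧
    ∃ C : ℝ, 0 < C ∧ ∀ h : H, (wordLength T h : ℝ) ≤ C * (wordLength S (h : G) : ℝ)

/-- `H` and `G` are finitely generated, and `H` is not undistorted in `G`, whatever the finite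
generating sets. -/
def Subgroup.IsDistorted {G : Type u} [Group G] (H : Subgroup G) : Prop :=
  Group.FG G ∧ H.FG ∧ ¬ H.IsUndistorted

/-!
Throughout, `BS(1, m)` is handled through its faithful action on `ℚ` by affine maps, in which `a`
is `z ↦ z + 1` and `t` is `z ↦ m z`; faithfulness follows from the normal form `t⁻ⁱ aᴺ tʲ`.

`BS(1, m)` is generated by an invertible and reversible automaton (`isInvertibleReversibleGroup`).
Division by `m` of `(m + 1)`-adic numbers, digit by digit, is done by an automaton whose states are
the carries `c ∈ {0, …, m - 1}`.  The state `c` acts as `z ↦ (z - c) / m`, so the states generate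
the group generated by `z ↦ z + 1` and `z ↦ m z`.

The subgroup `⟨a⟩` is distorted since `tⁿ a t⁻ⁿ = a ^ mⁿ` (`zpowers_genA_isDistorted`).

`BS(1, m)` is not generated by a bireversible automaton (`not_isBireversibleGroup`).  In a group `G`
generated by such an automaton, write `g|v` for the section of `g` at the word `v`, defined by
`g (v w) = g(v) g|v(w)`.  By bireversibility the letters of the alphabet permute the states and the
inverses of states, so `g ↦ g|v` is a bijection of `G` that maps each ball onto itself; this is all
that is used of the automaton (`SectionAction`).  Let now `G = BS(1, m)`.

* On the stabilizer of `v`, a subgroup of finite index, `g ↦ g|v` is an injective homomorphism to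
  `G`, hence is conjugation by an affine map `z ↦ r z + φ` of `ℚ` (`exists_isConjugator`), where
  `r` and `φ` depend on `v`.  In consequence, for all `g`, the maps `g|v` and `g` intertwine the
  affine maps of `v` and of `g(v)` (`IsConjugator.sec_eq`).
* As sections permute finite balls, averaging over a ball shows that `g|v` has the same slope as
  `g` (`slope_sec`), and then comparing the longest translations in a ball with their sections shows
  that `r = ± 1` (`abs_r`).
* Now `φ` grows at most linearly in the length of `v`.  But conjugation with `tⁿ` multiplies it by
  `mⁿ`, without any change in the length of the word.  So `φ = 0` if `r = 1` (`φ_eq_zero`), and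
  therefore `φ` is determined by `r`.
* Hence each `g` has at most two different sections, and is determined by the action of these two on
  the one-letter words.  So `G` is finite, which it is not (`isEmpty_sectionAction`).
-/

/-! ### The solvable Baumslag–Solitar groups as groups of affine maps -/

namespace BaumslagSolitar

variable {m : ℕ}

/-- The generator `a` of `BS(1, m)`. -/
def genA (m : ℕ) : BaumslagSolitar 1 m := PresentedGroup.of 0

/-- The generator `t` of `BS(1, m)`. -/
def genT (m : ℕ) : BaumslagSolitar 1 m := PresentedGroup.of 1

theorem genT_mul_genA : genT m * genA m = genA m ^ m * genT m := by
  have h : PresentedGroup.mk ({FreeGroup.of 1 * FreeGroup.of 0 ^ (1 : ℤ) * (FreeGroup.of 1)⁻¹ *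
      (FreeGroup.of 0 ^ (m : ℤ))⁻¹} : Set (FreeGroup (Fin 2)))
      (FreeGroup.of 1 * FreeGroup.of 0 ^ (1 : ℤ) * (FreeGroup.of 1)⁻¹ *
      (FreeGroup.of 0 ^ (m : ℤ))⁻¹) = 1 :=
    PresentedGroup.one_of_mem (Set.mem_singleton _)
  simp only [map_mul, map_inv, zpow_one, zpow_natCast, map_pow] at h
  exact mul_inv_eq_iff_eq_mul.1 (mul_inv_eq_one.1 h)

theorem genT_mul_genA_zpow (N : ℤ) : genT m * genA m ^ N = genA m ^ (m * N : ℤ) * genT m := by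
  have h : SemiconjBy (genT m) (genA m) (genA m ^ m) := genT_mul_genA
  have := h.zpow_right N
  rwa [← zpow_natCast, ← zpow_mul] at this

theorem genT_pow_mul_genA_zpow (j : ℕ) (N : ℤ) :
    genT m ^ j * genA m ^ N = genA m ^ (m ^ j * N : ℤ) * genT m ^ j := by
  induction j with
  | zero => simp
  | succ j ih =>
    rw [pow_succ', mul_assoc, ih, ← mul_assoc, genT_mul_genA_zpow, mul_assoc, pow_succ' (m : ℤ),
      mul_assoc (m : ℤ)]

theorem closure_generators : Subgroup.closure {genA m, genT m} = ⊤ := by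
  rw [← PresentedGroup.closure_range_of]
  congr 1
  ext g
  simp only [Set.mem_insert_iff, Set.mem_singleton_iff, Set.mem_range, Fin.exists_fin_two]
  exact or_congr eq_comm eq_comm

/-- Each element of `BS(1, m)` is of the form `t⁻ⁱ aᴺ tʲ`. -/
theorem exists_normalForm (g : BaumslagSolitar 1 m) :
    ∃ (i j : ℕ) (N : ℤ), g = (genT m ^ i)⁻¹ * genA m ^ N * genT m ^ j := by
  have hg : g ∈ Subgroup.closure {genA m, genT m} := closure_generators (m := m) ▸ trivial
  induction hg using Subgroup.closure_induction_right with
  | one => exact ⟨0, 0, 0, by simp⟩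
  | mul_right x hx y hy ih =>
    obtain ⟨i, j, N, rfl⟩ := ih
    rcases hy with rfl | rfl
    · refine ⟨i, j, N + m ^ j * 1, ?_⟩
      have h := genT_pow_mul_genA_zpow (m := m) j 1
      rw [zpow_one (genA m)] at h
      rw [mul_assoc, h, zpow_add]
      group
    · exact ⟨i, j + 1, N, by rw [pow_succ, ← mul_assoc]⟩
  | mul_inv_cancel x hx y hy ih =>
    obtain ⟨i, j, N, rfl⟩ := ih
    rcases hy with rfl | rfl
    · refine ⟨i, j, N + m ^ j * (-1), ?_⟩
      have := genT_pow_mul_genA_zpow (m := m) j (-1)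
      rw [zpow_neg_one] at this
      rw [mul_assoc, this, zpow_add]
      group
    · rcases j with _ | j
      · refine ⟨i + 1, 0, m * N, ?_⟩
        have := genT_mul_genA_zpow (m := m) N
        rw [← mul_inv_eq_iff_eq_mul] at this
        rw [← this]
        simp only [pow_zero, mul_one, pow_succ']
        group
      · refine ⟨i, j, N, ?_⟩
        rw [pow_succ]
        group

/-- A homomorphism on `BS(1, m)` is injective as soon as it separates the elements `aᴺ tʲ` from
the elements `tⁱ`. -/
theorem injective_of_normalForm {H : Type*} [Group H] (f : BaumslagSolitar 1 m →* H)
    (hf : ∀ (i j : ℕ) (N : ℤ), f (genA m) ^ N * f (genT m) ^ j = f (genT m) ^ i →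
      N = 0 ∧ i = j) : Function.Injective f := by
  rw [injective_iff_map_eq_one]
  intro g hg
  obtain ⟨i, j, N, rfl⟩ := exists_normalForm g
  rw [map_mul, map_mul, map_inv, mul_assoc, inv_mul_eq_one, map_pow, map_pow, map_zpow] at hg
  obtain ⟨rfl, rfl⟩ := hf i j N hg.symm
  simp

/-- A homomorphism from `BS(1, m)` given by images of the two generators. -/
def lift {H : Type*} [Group H] (a t : H) (h : t * a = a ^ m * t) : BaumslagSolitar 1 m →* H :=
  PresentedGroup.toGroup (f := ![a, t]) (by
    rintro r rfl
    simp [h])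

section lift
variable {H : Type*} [Group H] (a t : H) (h : t * a = a ^ m * t)

@[simp] theorem lift_genA : lift a t h (genA m) = a := by
  simp [lift, genA]

@[simp] theorem lift_genT : lift a t h (genT m) = t := by
  simp [lift, genT]

end lift

variable [NeZero m]

/-- The action of `BS(1, m)` on `ℚ` in which `a` acts as `z ↦ z + 1` and `t` as `z ↦ m z`. -/
def affine (m : ℕ) [NeZero m] : BaumslagSolitar 1 m →* Equiv.Perm ℚ :=
  lift (Equiv.addRight 1) (Equiv.mulLeft₀ (m : ℚ) (NeZero.ne _)) (by
    ext z
    simp [Equiv.Perm.mul_apply, mul_add])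

theorem affine_genA_zpow (N : ℤ) (z : ℚ) : affine m (genA m ^ N) z = z + N := by
  simp [affine]

theorem affine_genT_pow (j : ℕ) (z : ℚ) : affine m (genT m ^ j) z = m ^ j * z := by
  induction j with
  | zero => simp
  | succ j ih =>
    rw [pow_succ', map_mul, Equiv.Perm.mul_apply, ih]
    simp [affine, pow_succ', mul_assoc]

/-- The constant term of the affine map given by an element of `BS(1, m)`. -/
def shift (g : BaumslagSolitar 1 m) : ℚ := affine m g 0

/-- The slope of the affine map given by an element of `BS(1, m)`. -/
def slope (g : BaumslagSolitar 1 m) : ℚ := affine m g 1 - affine m g 0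

theorem affine_normalForm (i j : ℕ) (N : ℤ) (z : ℚ) :
    affine m ((genT m ^ i)⁻¹ * genA m ^ N * genT m ^ j) z = (m ^ j * z + N) / m ^ i := by
  have hm : (m : ℚ) ^ i ≠ 0 := pow_ne_zero _ (NeZero.ne _)
  rw [map_mul, map_mul, map_inv, Equiv.Perm.mul_apply, Equiv.Perm.mul_apply,
    Equiv.Perm.inv_eq_iff_eq, affine_genA_zpow, affine_genT_pow, affine_genT_pow]
  field_simp

theorem affine_apply (g : BaumslagSolitar 1 m) (z : ℚ) : affine m g z = slope g * z + shift g := by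
  obtain ⟨i, j, N, rfl⟩ := exists_normalForm g
  simp only [slope, shift, affine_normalForm]
  ring

theorem exists_slope_eq_zpow (g : BaumslagSolitar 1 m) : ∃ e : ℤ, slope g = (m : ℚ) ^ e := by
  obtain ⟨i, j, N, rfl⟩ := exists_normalForm g
  refine ⟨j - i, ?_⟩
  rw [zpow_sub₀ (NeZero.ne _)]
  simp only [slope, affine_normalForm, zpow_natCast]
  ring

theorem slope_pos (g : BaumslagSolitar 1 m) : 0 < slope g := by
  obtain ⟨e, he⟩ := exists_slope_eq_zpow g
  rw [he]
  exact zpow_pos (by exact_mod_cast NeZero.pos m) _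

theorem shift_mul (g h : BaumslagSolitar 1 m) : shift (g * h) = slope g * shift h + shift g := by
  rw [shift, map_mul, Equiv.Perm.mul_apply, affine_apply g]
  rfl

@[simp] theorem slope_mul (g h : BaumslagSolitar 1 m) : slope (g * h) = slope g * slope h := by
  rw [slope, map_mul, Equiv.Perm.mul_apply, Equiv.Perm.mul_apply, affine_apply g, affine_apply g,
    slope.eq_1 h]
  ring

@[simp] theorem slope_one : slope (1 : BaumslagSolitar 1 m) = 1 := by simp [slope]

@[simp] theorem shift_one : shift (1 : BaumslagSolitar 1 m) = 0 := by simp [shift]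

@[simp] theorem slope_pow (g : BaumslagSolitar 1 m) (n : ℕ) : slope (g ^ n) = slope g ^ n := by
  induction n with
  | zero => simp
  | succ n ih => simp [pow_succ, ih]

theorem slope_inv (g : BaumslagSolitar 1 m) : slope g⁻¹ = (slope g)⁻¹ :=
  eq_inv_of_mul_eq_one_left (by rw [← slope_mul, inv_mul_cancel, slope_one])

theorem slope_zpow (g : BaumslagSolitar 1 m) (n : ℤ) : slope (g ^ n) = slope g ^ n := by
  cases n <;> simp [slope_inv, zpow_negSucc]

theorem shift_pow (g : BaumslagSolitar 1 m) (n : ℕ) :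
    shift (g ^ n) = (∑ i ∈ Finset.range n, slope g ^ i) * shift g := by
  induction n with
  | zero => simp
  | succ n ih => rw [pow_succ, shift_mul, ih, slope_pow, Finset.sum_range_succ]; ring

theorem slope_genA_zpow (N : ℤ) : slope (genA m ^ N) = 1 := by
  simp only [slope, affine_genA_zpow]; ring

theorem shift_genA_zpow (N : ℤ) : shift (genA m ^ N) = N := by
  rw [shift, affine_genA_zpow, zero_add]

theorem slope_genT_pow (n : ℕ) : slope (genT m ^ n) = (m : ℚ) ^ n := by
  rw [slope, affine_genT_pow, affine_genT_pow]; ring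

theorem shift_genT_pow (n : ℕ) : shift (genT m ^ n) = 0 := by
  rw [shift, affine_genT_pow, mul_zero]

theorem genA_zpow_injective : Function.Injective fun N : ℤ => genA m ^ N := fun N N' h => by
  have := congrArg shift h
  simpa only [shift_genA_zpow, Int.cast_inj] using this

theorem affine_injective (hm : 2 ≤ m) : Function.Injective (affine m) := by
  refine injective_of_normalForm _ fun i j N h => ?_
  rw [← map_zpow, ← map_pow, ← map_pow, ← map_mul] at h
  have key (z : ℚ) : (m : ℚ) ^ j * z + N = m ^ i * z := by
    have := DFunLike.congr_fun h z
    rwa [map_mul, Equiv.Perm.mul_apply, affine_genA_zpow, affine_genT_pow, affine_genT_pow] at this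
  have h0 : N = 0 := by simpa using key 0
  refine ⟨h0, ?_⟩
  have h1 := key 1
  rw [h0] at h1
  have h2 : m ^ j = m ^ i := by exact_mod_cast (by simpa using h1 : (m : ℚ) ^ j = m ^ i)
  exact (Nat.pow_right_injective hm h2).symm

theorem ext_slope_shift (hm : 2 ≤ m) {g h : BaumslagSolitar 1 m} (h1 : slope g = slope h)
    (h2 : shift g = shift h) : g = h :=
  affine_injective hm <| Equiv.ext fun z => by rw [affine_apply, affine_apply, h1, h2]

end BaumslagSolitar

/-! ### Distortion of the subgroup generated by `a` -/

section wordLength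

variable {G : Type u} [Group G]

theorem wordLength_le_of_list (S : Set G) (l : List G) (hl : ∀ x ∈ l, x ∈ S ∨ x⁻¹ ∈ S) :
    wordLength S l.prod ≤ l.length :=
  Nat.sInf_le ⟨l, hl, rfl, rfl⟩

theorem exists_list_length_eq_wordLength {S : Set G} (hS : Subgroup.closure S = ⊤) (g : G) :
    ∃ l : List G, (∀ x ∈ l, x ∈ S ∨ x⁻¹ ∈ S) ∧ l.prod = g ∧ l.length = wordLength S g := by
  have hg : g ∈ (Subgroup.closure S).toSubmonoid := hS ▸ trivial
  rw [Subgroup.closure_toSubmonoid] at hg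
  obtain ⟨l, hl, hg⟩ := Submonoid.exists_list_of_mem_closure hg
  exact Nat.sInf_mem (s := {n | ∃ l : List G, (∀ x ∈ l, x ∈ S ∨ x⁻¹ ∈ S) ∧ l.prod = g ∧
    l.length = n}) ⟨_, l, hl, hg, rfl⟩

theorem wordLength_mul_le {S : Set G} (hS : Subgroup.closure S = ⊤) (g h : G) :
    wordLength S (g * h) ≤ wordLength S g + wordLength S h := by
  obtain ⟨l, hl, rfl, hlen⟩ := exists_list_length_eq_wordLength hS g
  obtain ⟨l', hl', rfl, hlen'⟩ := exists_list_length_eq_wordLength hS h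
  rw [← hlen, ← hlen', ← List.prod_append, ← List.length_append]
  refine wordLength_le_of_list S _ fun x hx => ?_
  rcases List.mem_append.1 hx with hx | hx
  exacts [hl x hx, hl' x hx]

theorem wordLength_pow_le {S : Set G} (hS : Subgroup.closure S = ⊤) (g : G) (n : ℕ) :
    wordLength S (g ^ n) ≤ n * wordLength S g := by
  induction n with
  | zero => simpa using wordLength_le_of_list S [] (by simp)
  | succ n ih =>
    rw [pow_succ, add_mul, one_mul]
    exact (wordLength_mul_le hS _ _).trans (by gcongr)

/-- A homomorphism to `ℤ` is Lipschitz for the word length of a finite generating set. -/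
theorem exists_natAbs_le_mul_wordLength {S : Set G} (hfin : S.Finite)
    (hS : Subgroup.closure S = ⊤) (f : G → ℤ) (hf : ∀ g h, f (g * h) = f g + f h) :
    ∃ E : ℕ, ∀ g, (f g).natAbs ≤ E * wordLength S g := by
  obtain ⟨E, hE⟩ := (hfin.image fun g => (f g).natAbs).bddAbove
  have h1 : f 1 = 0 := by simpa using hf 1 1
  have hinv (g : G) : f g⁻¹ = -f g := by
    have := hf g g⁻¹
    rw [mul_inv_cancel, h1] at this
    linarith
  refine ⟨E, fun g => ?_⟩
  obtain ⟨l, hl, rfl, hlen⟩ := exists_list_length_eq_wordLength hS g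
  rw [← hlen]
  clear hlen
  induction l with
  | nil => simp [h1]
  | cons x l ih =>
    have hx : (f x).natAbs ≤ E := by
      rcases hl x (by simp) with hx | hx
      · exact hE ⟨x, hx, rfl⟩
      · have := hE ⟨x⁻¹, hx, rfl⟩
        simpa only [hinv, Int.natAbs_neg] using this
    have := ih fun y hy => hl y (by simp [hy])
    rw [List.prod_cons, hf, List.length_cons, mul_add, mul_one]
    have := Int.natAbs_add_le (f x) (f l.prod)
    omega

end wordLength

namespace BaumslagSolitar

variable {m : ℕ}

theorem genT_pow_conj_genA (n : ℕ) :
    genT m ^ n * genA m * (genT m ^ n)⁻¹ = genA m ^ (m ^ n) := by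
  have h := genT_pow_mul_genA_zpow (m := m) n 1
  rw [zpow_one (genA m), mul_one ((m : ℤ) ^ n)] at h
  rw [h, mul_inv_cancel_right]
  exact_mod_cast zpow_natCast (genA m) (m ^ n)

/-- The element `a ^ mⁿ = tⁿ a t⁻ⁿ` has length linear in `n` in `BS(1, m)`, but its length in `⟨a⟩`
is exponential in `n`. -/
theorem zpowers_genA_isDistorted (hm : 2 ≤ m) : (Subgroup.zpowers (genA m)).IsDistorted := by
  have : NeZero m := ⟨by omega⟩
  refine ⟨Group.fg_iff.2 ⟨_, closure_generators, by simp⟩,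
    (Subgroup.fg_iff _).2 ⟨{genA m}, (Subgroup.zpowers_eq_closure _).symm, by simp⟩, ?_⟩
  rintro ⟨S, T, -, hT, hS, hTgen, C, hC, h⟩
  have hex (g : Subgroup.zpowers (genA m)) : ∃ N : ℤ, genA m ^ N = g := g.2
  choose f hf using hex
  have hmul (g h) : f (g * h) = f g + f h := by
    apply genA_zpow_injective (m := m)
    simp only [hf, zpow_add, Subgroup.coe_mul]
  obtain ⟨E, hE⟩ := exists_natAbs_le_mul_wordLength hT hTgen f hmul
  set α := wordLength S (genA m)
  set τ := wordLength S (genT m)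
  set τ' := wordLength S (genT m)⁻¹
  have key (n : ℕ) : ((m ^ n : ℕ) : ℝ) ≤ E * (C * (n * (τ + τ') + α)) := by
    let g : Subgroup.zpowers (genA m) := ⟨genA m ^ (m ^ n), Subgroup.npow_mem_zpowers _ _⟩
    have h1 : f g = (m ^ n : ℕ) := by
      apply genA_zpow_injective (m := m)
      simp only [hf, zpow_natCast, g]
    have h2 := hE g
    rw [h1, Int.natAbs_natCast] at h2
    have h3 : wordLength S (g : BaumslagSolitar 1 m) ≤ n * (τ + τ') + α := by
      change wordLength S (genA m ^ (m ^ n)) ≤ _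
      rw [← genT_pow_conj_genA, ← inv_pow]
      have := wordLength_mul_le hS (genT m ^ n * genA m) ((genT m)⁻¹ ^ n)
      have := wordLength_mul_le hS (genT m ^ n) (genA m)
      have := wordLength_pow_le hS (genT m) n
      have := wordLength_pow_le hS (genT m)⁻¹ n
      simp only [τ, τ', α, mul_add]
      omega
    calc ((m ^ n : ℕ) : ℝ) ≤ E * wordLength T g := by exact_mod_cast h2
      _ ≤ E * (C * wordLength S (g : BaumslagSolitar 1 m)) := by gcongr; exact h g
      _ ≤ _ := by gcongr; exact_mod_cast h3
  have hlim : Filter.Tendsto (fun n : ℕ => (n : ℝ) ^ 1 / (m : ℝ) ^ n) Filter.atTop (nhds 0) :=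
    tendsto_pow_const_div_const_pow_of_one_lt 1 (by exact_mod_cast hm)
  have hlim' : Filter.Tendsto (fun n : ℕ => (n : ℝ) ^ 0 / (m : ℝ) ^ n) Filter.atTop (nhds 0) :=
    tendsto_pow_const_div_const_pow_of_one_lt 0 (by exact_mod_cast hm)
  have hlim2 := (hlim.const_mul (E * C * (τ + τ') : ℝ)).add (hlim'.const_mul (E * C * α : ℝ))
  simp only [mul_zero, add_zero] at hlim2
  obtain ⟨n, hn⟩ := (hlim2.eventually (gt_mem_nhds zero_lt_one)).exists
  have hpos : (0 : ℝ) < (m : ℝ) ^ n := by positivity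
  have := key n
  rw [pow_one, pow_zero, mul_div_assoc', mul_div_assoc', ← add_div, div_lt_one hpos] at hn
  push_cast at this
  nlinarith

end BaumslagSolitar

/-! ### An invertible and reversible automaton that generates `BS(1, m)` -/

namespace MealyAutomaton

variable {A : Type u} {Q : Type v}

/-- The group generated by an automaton is the group of permutations generated by its states. -/
theorem action_range (M : MealyAutomaton A Q) (h : M.IsInvertible) :
    (M.action h).range = Subgroup.closure (Set.range (M.statePerm h)) :=
  FreeGroup.range_lift_eq_closure

/-- The automaton dividing by `m` in the `(m + 1)`-adic numbers: the state `c` reads `e`, outputs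
`d` and moves to `c'`, where `(m + 1) c' + e = m d + c`, which means that `d` and `c'` are the
residues of `c - e` modulo `m + 1` and modulo `m`.  So the state `c` acts on words, read as
`(m + 1)`-adic expansions with the lowest digit first, as `z ↦ (z - c) / m`. -/
def division (m : ℕ) [NeZero m] : MealyAutomaton (Fin (m + 1)) (Fin m) where
  output c e := c.castSucc - e
  transition c e := c - Fin.ofNat m e
  finite_alphabet := inferInstance
  finite_states := inferInstance

theorem outputWord_length {A : Type u} {Q : Type v} (M : MealyAutomaton A Q) (q : Q) (w : List A) :
    (M.outputWord q w).length = w.length := by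
  induction w generalizing q with
  | nil => rfl
  | cons a w ih => simp [outputWord, ih]

/-- The number that a word over `{0, …, m}` represents in base `m + 1`, lowest digit first. -/
def value {m : ℕ} : List (Fin (m + 1)) → ℤ
  | [] => 0
  | e :: w => e + (m + 1) * value w

theorem value_injective {m : ℕ} {w w' : List (Fin (m + 1))} (hlen : w.length = w'.length)
    (h : value w ≡ value w' [ZMOD (m + 1) ^ w.length]) : w = w' := by
  induction w generalizing w' with
  | nil => exact (List.length_eq_zero_iff.1 hlen.symm).symm
  | cons e w ih =>
    obtain _ | ⟨e', w'⟩ := w'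
    · simp at hlen
    rw [List.length_cons, List.length_cons, Nat.add_right_cancel_iff] at hlen
    rw [List.length_cons, pow_succ', value, value] at h
    have he : (e : ℤ) = e' := by
      have h1 : (e : ℤ) ≡ e' [ZMOD (m + 1)] := by
        have := h.of_mul_right _
        simpa [Int.ModEq] using this
      rwa [Int.ModEq, Int.emod_eq_of_lt (by positivity) (by exact_mod_cast e.2),
        Int.emod_eq_of_lt (by positivity) (by exact_mod_cast e'.2)] at h1
    rw [he] at h
    have h2 := Int.ModEq.add_left_cancel' _ h
    rw [Fin.ext (by exact_mod_cast he : (e : ℕ) = e'),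
      ih hlen (h2.mul_left_cancel' (by positivity))]

section division

variable {m : ℕ} [NeZero m]

theorem division_isInvertible : (division m).IsInvertible := fun c =>
  (Equiv.subLeft c.castSucc).bijective

theorem division_isReversible : (division m).IsReversible := fun e =>
  (Equiv.subRight (Fin.ofNat m e)).bijective

theorem division_spec (c : Fin m) (e : Fin (m + 1)) :
    (m + 1) * ((division m).transition c e : ℕ) + e = m * ((division m).output c e : ℕ) + c := by
  obtain ⟨c, hc⟩ := c
  obtain ⟨e, he⟩ := e
  simp only [division, Fin.val_sub, Fin.val_ofNat, Fin.castSucc_mk]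
  rcases le_or_gt e c with h | h
  · obtain ⟨k, rfl⟩ := Nat.exists_eq_add_of_le h
    rw [Nat.mod_eq_of_lt (by omega : e < m), show m - e + (e + k) = k + m by omega,
      show m + 1 - e + (e + k) = k + (m + 1) by omega, Nat.add_mod_right, Nat.add_mod_right,
      Nat.mod_eq_of_lt (by omega), Nat.mod_eq_of_lt (by omega)]
    ring
  · obtain ⟨k, hk⟩ := Nat.exists_eq_add_of_le (by omega : e ≤ m)
    rw [show m + 1 - e + c = k + c + 1 by omega, Nat.mod_eq_of_lt (a := k + c + 1) (by omega)]
    rcases eq_or_ne e m with rfl | hne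
    · obtain rfl : k = 0 := by omega
      rw [Nat.mod_self, Nat.sub_zero, Nat.add_mod_left, Nat.mod_eq_of_lt hc]
      ring
    · rw [Nat.mod_eq_of_lt (by omega : e < m), show m - e + c = k + c by omega,
        Nat.mod_eq_of_lt (by omega)]
      nlinarith

theorem value_division_outputWord (c : Fin m) (w : List (Fin (m + 1))) :
    m * value ((division m).outputWord c w) + c ≡ value w [ZMOD (m + 1) ^ w.length] := by
  induction w generalizing c with
  | nil => exact Int.modEq_one
  | cons e w ih =>
    have h1 : ((m : ℤ) + 1) * ((division m).transition c e : ℕ) + (e : ℕ) =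
        m * ((division m).output c e : ℕ) + (c : ℕ) := by exact_mod_cast division_spec c e
    have h2 := ((ih ((division m).transition c e)).mul_left' (c := (m : ℤ) + 1)).add_left (e : ℤ)
    rw [List.length_cons, pow_succ', outputWord, value, value]
    convert h2 using 1
    linear_combination -h1

end division

end MealyAutomaton

namespace BaumslagSolitar

open MealyAutomaton

/-- A permutation of words preserves lengths and acts on the represented `(m + 1)`-adic numbers as
`z ↦ μ z + κ`. -/
def ActsAffinely {m : ℕ} (g : Equiv.Perm (List (Fin (m + 1)))) (μ κ : ℤ) : Prop :=
  ∀ w, (g w).length = w.length ∧ value (g w) ≡ μ * value w + κ [ZMOD (m + 1) ^ w.length]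

namespace ActsAffinely

variable {m : ℕ} {g h : Equiv.Perm (List (Fin (m + 1)))} {μ κ μ' κ' : ℤ}

theorem mul (hg : ActsAffinely g μ κ) (hh : ActsAffinely h μ' κ') :
    ActsAffinely (g * h) (μ * μ') (μ * κ' + κ) := fun w => by
  obtain ⟨h1, h2⟩ := hh w
  obtain ⟨h3, h4⟩ := hg (h w)
  refine ⟨h3.trans h1, ?_⟩
  rw [h1] at h4
  refine h4.trans ?_
  convert (h2.mul_left μ).add_right κ using 1
  ring

theorem one : ActsAffinely (1 : Equiv.Perm (List (Fin (m + 1)))) 1 0 := fun w => ⟨rfl, by simp⟩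

theorem pow (hg : ActsAffinely g μ 0) (n : ℕ) : ActsAffinely (g ^ n) (μ ^ n) 0 := by
  induction n with
  | zero => simpa using one
  | succ n ih => simpa [pow_succ] using ih.mul hg

theorem translation_pow (hg : ActsAffinely g 1 κ) (n : ℕ) : ActsAffinely (g ^ n) 1 (n * κ) := by
  induction n with
  | zero => simpa using one
  | succ n ih =>
    have := ih.mul hg
    rw [← pow_succ] at this
    convert this using 1
    · rw [mul_one]
    · push_cast
      ring

theorem inv (hg : ActsAffinely g 1 κ) : ActsAffinely g⁻¹ 1 (-κ) := fun w => by
  obtain ⟨h1, h2⟩ := hg (g⁻¹ w)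
  rw [← Equiv.Perm.mul_apply, mul_inv_cancel, Equiv.Perm.one_apply] at h1 h2
  refine ⟨h1.symm, ?_⟩
  rw [← h1] at h2
  have := (h2.symm.add_right (-κ))
  simpa using this

theorem translation_zpow (hg : ActsAffinely g 1 κ) (n : ℤ) : ActsAffinely (g ^ n) 1 (n * κ) := by
  cases n with
  | ofNat n => simpa using hg.translation_pow n
  | negSucc n =>
    rw [zpow_negSucc]
    convert (hg.translation_pow (n + 1)).inv using 1
    rw [Int.negSucc_eq]
    push_cast
    ring

theorem eq (hg : ActsAffinely g μ κ) (hh : ActsAffinely h μ κ) : g = h :=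
  Equiv.ext fun w => value_injective ((hg w).1.trans (hh w).1.symm) (by
    rw [(hg w).1]
    exact (hg w).2.trans (hh w).2.symm)

/-- The affine map is determined by the permutation, since its values at `0` and `1` are known
modulo all powers of `m + 1`. -/
theorem unique [NeZero m] (hg : ActsAffinely g μ κ) (hg' : ActsAffinely g μ' κ') :
    κ = κ' ∧ μ = μ' := by
  have hm : 0 < m := NeZero.pos m
  have hmod {x y : ℤ} (hxy : ∀ n : ℕ, x ≡ y [ZMOD (m + 1) ^ n]) : x = y := by
    obtain ⟨n, hn⟩ := pow_unbounded_of_one_lt (|y - x|) (by omega : (1 : ℤ) < m + 1)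
    have := Int.eq_zero_of_abs_lt_dvd ((hxy n).dvd) hn
    linarith
  have h0 (n : ℕ) : value (List.replicate n (0 : Fin (m + 1))) = 0 := by
    induction n with
    | zero => rfl
    | succ n ih => simp [List.replicate_succ, value, ih]
  have hκ : κ = κ' := hmod fun n => by
    have := (hg (List.replicate n 0)).2.symm.trans (hg' (List.replicate n 0)).2
    simpa [h0] using this
  refine ⟨hκ, hmod fun n => ?_⟩
  have := (hg (1 :: List.replicate n 0)).2.symm.trans (hg' (1 :: List.replicate n 0)).2
  have h1 : ((1 : Fin (m + 1)) : ℕ) = 1 := by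
    rw [Fin.val_one', Nat.mod_eq_of_lt (by omega)]
  rw [List.length_cons, List.length_replicate, value, h0, h1, hκ] at this
  have := Int.ModEq.add_right_cancel' _ this
  rw [pow_succ] at this
  simpa using this.of_mul_right _

end ActsAffinely

theorem isInvertibleReversibleGroup {m : ℕ} (hm : 2 ≤ m) :
    IsInvertibleReversibleGroup (BaumslagSolitar 1 m) := by
  have : NeZero m := ⟨by omega⟩
  set P := (division m).statePerm division_isInvertible with hP
  have hPval (c : Fin m) (w) : (P c w).length = w.length ∧
      m * value (P c w) + c ≡ value w [ZMOD (m + 1) ^ w.length] :=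
    ⟨outputWord_length _ _ _, value_division_outputWord c w⟩
  -- the inverse of the state `c` acts as `z ↦ m z + c`
  have hinv (c : Fin m) : ActsAffinely (P c)⁻¹ m c := fun w => by
    obtain ⟨h1, h2⟩ := hPval c ((P c)⁻¹ w)
    rw [← Equiv.Perm.mul_apply, mul_inv_cancel, Equiv.Perm.one_apply] at h1 h2
    exact ⟨h1.symm, by rw [h1]; exact h2.symm⟩
  let i0 : Fin m := ⟨0, by omega⟩
  let i1 : Fin m := ⟨1, by omega⟩
  set τ := (P i0)⁻¹ with hτ
  set α := (P i1)⁻¹ * P i0 with hα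
  have hτa : ActsAffinely τ m 0 := hinv i0
  have hαa : ActsAffinely α 1 1 := fun w => by
    obtain ⟨h1, h2⟩ := hPval i0 w
    obtain ⟨h3, h4⟩ := hinv i1 (P i0 w)
    refine ⟨h3.trans h1, ?_⟩
    rw [h1] at h4
    refine h4.trans ?_
    rw [one_mul]
    simpa [i0, i1] using h2.add_right 1
  have hrel : τ * α = α ^ m * τ :=
    (hτa.mul hαa).eq (by simpa using (hαa.translation_pow m).mul hτa)
  let f : BaumslagSolitar 1 m →* Equiv.Perm (List (Fin (m + 1))) := lift α τ hrel
  have hf : Function.Injective f := injective_of_normalForm f fun i j N h => by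
    simp only [f, lift_genA, lift_genT] at h
    have h1 := (hαa.translation_zpow N).mul (hτa.pow j)
    rw [h] at h1
    obtain ⟨h2, h3⟩ := h1.unique (hτa.pow i)
    refine ⟨by simpa using h2, ?_⟩
    have : m ^ j = m ^ i := by exact_mod_cast (by simpa using h3 : (m : ℤ) ^ j = m ^ i)
    exact (Nat.pow_right_injective hm this).symm
  have hrange : f.range = ((division m).action division_isInvertible).range := by
    rw [action_range]
    apply le_antisymm
    · rw [MonoidHom.range_eq_map, ← closure_generators, MonoidHom.map_closure,
        Subgroup.closure_le]
      have hmem (c : Fin m) : P c ∈ Subgroup.closure (Set.range P) :=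
        Subgroup.subset_closure ⟨c, rfl⟩
      rintro _ ⟨g, rfl | rfl, rfl⟩
      · simp only [f, lift_genA]
        exact mul_mem (inv_mem (hmem _)) (hmem _)
      · simp only [f, lift_genT]
        exact inv_mem (hmem _)
    · rw [Subgroup.closure_le]
      rintro _ ⟨c, rfl⟩
      have h1 : (P c)⁻¹ = f (genA m ^ (c : ℕ) * genT m) :=
        (hinv c).eq (by simpa [f] using (hαa.translation_pow c).mul hτa)
      exact inv_mem_iff.1 (h1 ▸ ⟨_, rfl⟩ : (P c)⁻¹ ∈ f.range)
  exact ⟨Fin (m + 1), Fin m, division m, ⟨division_isInvertible, division_isReversible⟩,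
    ⟨(MonoidHom.ofInjective hf).trans ((MulEquiv.subgroupCongr hrange).trans
      (QuotientGroup.quotientKerEquivRange _).symm)⟩⟩

end BaumslagSolitar

/-! ### Sections in groups generated by bireversible automata -/

/-- A faithful length-preserving action of `G` on the words over `A`, in which each element `g`
induces on the words with prefix `v` the action of an element of `G`, the section of `g` at `v`;
and an exhaustion of `G` by finite sets each of which is mapped onto itself by the sections at any
word. -/
structure SectionAction (G : Type u) [Group G] (A : Type v) where
  /-- the action on words -/
  act : G →* Equiv.Perm (List A)
  act_injective : Function.Injective act
  length_act (g : G) (w : List A) : (act g w).length = w.length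
  /-- the section of an element at a word -/
  sec : G → List A → G
  act_append (g : G) (v w : List A) : act g (v ++ w) = act g v ++ act (sec g v) w
  /-- the finite sets that exhaust the group -/
  ball : ℕ → Set G
  finite_ball (n : ℕ) : (ball n).Finite
  exists_mem_ball (g : G) : ∃ n, g ∈ ball n
  ball_mono : Monotone ball
  sec_image_ball (v : List A) (n : ℕ) : (sec · v) '' ball n = ball n

namespace MealyAutomaton

variable {A : Type u} {Q : Type v} (M : MealyAutomaton A Q) (h : M.IsInvertible)

theorem statePerm_cons (q : Q) (a : A) (w : List A) :
    M.statePerm h q (a :: w) = M.output q a :: M.statePerm h (M.transition q a) w := rfl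

theorem statePerm_inv_cons (q : Q) (a : A) (w : List A) :
    (M.statePerm h q)⁻¹ (M.output q a :: w) = a :: (M.statePerm h (M.transition q a))⁻¹ w := by
  rw [Equiv.Perm.inv_eq_iff_eq, statePerm_cons, ← Equiv.Perm.mul_apply, mul_inv_cancel,
    Equiv.Perm.one_apply]

/-- The permutation given by a state or, if the boolean is `false`, by its inverse. -/
noncomputable def letterPerm (p : Q × Bool) : Equiv.Perm (List A) :=
  cond p.2 (M.statePerm h p.1) (M.statePerm h p.1)⁻¹

/-- The permutation given by a word in the states and their inverses. -/
noncomputable def wordPerm (L : List (Q × Bool)) : Equiv.Perm (List A) :=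
  M.action h (FreeGroup.mk L)

theorem wordPerm_nil : M.wordPerm h [] = 1 := map_one _

theorem wordPerm_cons (p : Q × Bool) (L : List (Q × Bool)) :
    M.wordPerm h (p :: L) = M.letterPerm h p * M.wordPerm h L := by
  simp only [wordPerm, action, FreeGroup.lift_mk, List.map_cons, List.prod_cons]
  rfl

theorem exists_letterPerm_section (p : Q × Bool) (a : A) :
    ∃ (p' : Q × Bool) (b : A), ∀ w, M.letterPerm h p (a :: w) = b :: M.letterPerm h p' w := by
  obtain ⟨q, _ | _⟩ := p
  · obtain ⟨b, rfl⟩ := (h q).2 a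
    exact ⟨(M.transition q b, false), b, M.statePerm_inv_cons h q b⟩
  · exact ⟨(M.transition q a, true), M.output q a, M.statePerm_cons h q a⟩

/-- By reversibility every state is a section of a state at the letter `a`, and by bireversibility
every inverse of a state is a section of the inverse of a state. -/
theorem IsBireversible.exists_letterPerm_section_eq (hM : M.IsBireversible) (p' : Q × Bool)
    (a : A) : ∃ (p : Q × Bool) (b : A),
      ∀ w, M.letterPerm hM.1 p (a :: w) = b :: M.letterPerm hM.1 p' w := by
  obtain ⟨q, _ | _⟩ := p'
  · obtain ⟨⟨q', b⟩, hq⟩ := hM.2.2.2 (a, q)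
    simp only [Prod.mk.injEq] at hq
    obtain ⟨rfl, rfl⟩ := hq
    exact ⟨(q', false), b, M.statePerm_inv_cons hM.1 q' b⟩
  · obtain ⟨q', rfl⟩ := (hM.2.1 a).2 q
    exact ⟨(q', true), M.output q' a, M.statePerm_cons hM.1 q' a⟩

theorem exists_wordPerm_cons (L : List (Q × Bool)) (a : A) :
    ∃ (L' : List (Q × Bool)) (b : A), L'.length = L.length ∧
      ∀ w, M.wordPerm h L (a :: w) = b :: M.wordPerm h L' w := by
  induction L with
  | nil => exact ⟨[], a, rfl, fun w => by simp [wordPerm_nil]⟩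
  | cons p L ih =>
    obtain ⟨L', b, hlen, hL⟩ := ih
    obtain ⟨p', b', hp⟩ := M.exists_letterPerm_section h p b
    exact ⟨p' :: L', b', by simp [hlen], fun w => by
      rw [wordPerm_cons, wordPerm_cons, Equiv.Perm.mul_apply, hL, hp, Equiv.Perm.mul_apply]⟩

theorem IsBireversible.exists_wordPerm_cons_eq (hM : M.IsBireversible) (L' : List (Q × Bool))
    (a : A) : ∃ (L : List (Q × Bool)) (b : A), L.length = L'.length ∧
      ∀ w, M.wordPerm hM.1 L (a :: w) = b :: M.wordPerm hM.1 L' w := by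
  induction L' with
  | nil => exact ⟨[], a, rfl, fun w => by simp [wordPerm_nil]⟩
  | cons p' L' ih =>
    obtain ⟨L, b, hlen, hL⟩ := ih
    obtain ⟨p, b', hp⟩ := hM.exists_letterPerm_section_eq M p' b
    exact ⟨p :: L, b', by simp [hlen], fun w => by
      rw [wordPerm_cons, wordPerm_cons, Equiv.Perm.mul_apply, hL, hp, Equiv.Perm.mul_apply]⟩

theorem wordPerm_apply_nil (L : List (Q × Bool)) : M.wordPerm h L [] = [] := by
  induction L with
  | nil => simp [wordPerm_nil]
  | cons p L ih =>
    rw [wordPerm_cons, Equiv.Perm.mul_apply, ih]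
    obtain ⟨q, _ | _⟩ := p
    · exact Equiv.Perm.inv_eq_iff_eq.2 rfl
    · rfl

theorem exists_wordPerm_append (L : List (Q × Bool)) (v : List A) :
    ∃ L' : List (Q × Bool), L'.length = L.length ∧
      ∀ w, M.wordPerm h L (v ++ w) = M.wordPerm h L v ++ M.wordPerm h L' w := by
  induction v generalizing L with
  | nil => exact ⟨L, rfl, fun w => by simp [wordPerm_apply_nil]⟩
  | cons a v ih =>
    obtain ⟨L₁, b, h₁, hL₁⟩ := M.exists_wordPerm_cons h L a
    obtain ⟨L₂, h₂, hL₂⟩ := ih L₁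
    exact ⟨L₂, h₂.trans h₁, fun w => by simp [hL₁, hL₂]⟩

theorem IsBireversible.exists_wordPerm_append_eq (hM : M.IsBireversible) (L' : List (Q × Bool))
    (v : List A) : ∃ L : List (Q × Bool), L.length = L'.length ∧
      ∀ w, M.wordPerm hM.1 L (v ++ w) = M.wordPerm hM.1 L v ++ M.wordPerm hM.1 L' w := by
  induction v with
  | nil => exact ⟨L', rfl, fun w => by simp [wordPerm_apply_nil]⟩
  | cons a v ih =>
    obtain ⟨L₂, h₂, hL₂⟩ := ih
    obtain ⟨L₁, b, h₁, hL₁⟩ := hM.exists_wordPerm_cons_eq M L₂ a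
    exact ⟨L₁, h₁.trans h₂, fun w => by simp [hL₁, hL₂]⟩

theorem length_wordPerm (L : List (Q × Bool)) (w : List A) :
    (M.wordPerm h L w).length = w.length := by
  induction w generalizing L with
  | nil => rw [wordPerm_apply_nil]
  | cons a w ih =>
    obtain ⟨L', b, -, hL⟩ := M.exists_wordPerm_cons h L a
    rw [hL, List.length_cons, ih, List.length_cons]

/-- A group generated by a bireversible automaton has sections that permute the balls of the word
length: as the sections at a word map the words in the states and their inverses onto themselves,
they are surjective on each ball. -/
theorem IsBireversible.nonempty_sectionAction (hM : M.IsBireversible) {G : Type*} [Group G]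
    (e : G ≃* M.generatedGroup hM.1) : Nonempty (SectionAction G A) := by
  have := M.finite_states
  let act : G →* Equiv.Perm (List A) := (QuotientGroup.kerLift (M.action hM.1)).comp e.toMonoidHom
  have hinj : Function.Injective act :=
    (QuotientGroup.kerLift_injective (M.action hM.1)).comp e.injective
  have hlist (g : G) : ∃ L, act g = M.wordPerm hM.1 L := by
    obtain ⟨x, hx⟩ := QuotientGroup.mk_surjective (e g)
    obtain ⟨L, rfl⟩ := Quot.exists_rep x
    exact ⟨L, by simp only [act, MonoidHom.comp_apply]; exact congrArg _ hx.symm⟩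
  have hlist' (L) : ∃ g : G, act g = M.wordPerm hM.1 L :=
    ⟨e.symm (QuotientGroup.mk (FreeGroup.mk L)), by simp [act, wordPerm]⟩
  have hsec (g : G) (v : List A) : ∃ g' : G, ∀ w, act g (v ++ w) = act g v ++ act g' w := by
    obtain ⟨L, hL⟩ := hlist g
    obtain ⟨L', -, hL'⟩ := M.exists_wordPerm_append hM.1 L v
    obtain ⟨g', hg'⟩ := hlist' L'
    exact ⟨g', fun w => by rw [hL, hL', hg']⟩
  choose sec hsec using hsec
  refine ⟨⟨act, hinj, fun g w => ?_, sec, hsec,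
    fun n => act ⁻¹' (M.wordPerm hM.1 '' {L | L.length ≤ n}), fun n => ?_, fun g => ?_,
    fun n n' hn g => ?_, fun v n => ?_⟩⟩
  · obtain ⟨L, hL⟩ := hlist g
    rw [hL, length_wordPerm]
  · exact ((List.finite_length_le _ n).image _).preimage hinj.injOn
  · obtain ⟨L, hL⟩ := hlist g
    exact ⟨L.length, L, le_refl L.length, hL.symm⟩
  · rintro ⟨L, hL, hg⟩
    exact ⟨L, le_trans hL hn, hg⟩
  · apply Set.Subset.antisymm
    · rintro _ ⟨g, ⟨L, hL, hg⟩, rfl⟩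
      obtain ⟨L', hlen, hL'⟩ := M.exists_wordPerm_append hM.1 L v
      refine ⟨L', hlen.trans_le hL, Equiv.ext fun w => ?_⟩
      have := hsec g v w
      rw [← hg, hL'] at this
      exact List.append_cancel_left this
    · rintro g' ⟨L', hL', hg'⟩
      obtain ⟨L, hlen, hL⟩ := hM.exists_wordPerm_append_eq M L' v
      obtain ⟨g, hg⟩ := hlist' L
      refine ⟨g, ⟨L, hlen.trans_le hL', hg.symm⟩, hinj (Equiv.ext fun w => ?_)⟩
      have := hsec g v w
      rw [hg, hL, hg'] at this
      exact (List.append_cancel_left this).symm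

end MealyAutomaton

namespace SectionAction

variable {G : Type u} [Group G] {A : Type v} (S : SectionAction G A)

theorem sec_eq {g g' : G} {v : List A}
    (h : ∀ w, S.act g (v ++ w) = S.act g v ++ S.act g' w) : S.sec g v = g' :=
  S.act_injective <| Equiv.ext fun w =>
    List.append_cancel_left ((S.act_append g v w).symm.trans (h w))

theorem act_mul (g h : G) (w : List A) : S.act (g * h) w = S.act g (S.act h w) := by
  rw [map_mul, Equiv.Perm.mul_apply]

theorem act_one (w : List A) : S.act 1 w = w := by simp

theorem sec_mul (g h : G) (v : List A) :
    S.sec (g * h) v = S.sec g (S.act h v) * S.sec h v :=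
  S.sec_eq fun w => by rw [act_mul, S.act_append h, S.act_append g, act_mul, act_mul]

theorem sec_append (g : G) (u v : List A) : S.sec g (u ++ v) = S.sec (S.sec g u) v :=
  S.sec_eq fun w => by simp only [List.append_assoc, act_append]

theorem act_nil (g : G) : S.act g [] = [] :=
  List.length_eq_zero_iff.1 (S.length_act g [])

theorem sec_nil (g : G) : S.sec g [] = g := S.sec_eq fun w => by simp [act_nil]

theorem sec_one (v : List A) : S.sec 1 v = 1 := S.sec_eq fun w => by simp

theorem act_pow_of_fixed {g : G} {v : List A} (h : S.act g v = v) (n : ℕ) :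
    S.act (g ^ n) v = v := by
  rw [map_pow]
  exact Equiv.Perm.pow_apply_eq_self_of_apply_eq_self h n

theorem act_inv_of_fixed {g : G} {v : List A} (h : S.act g v = v) : S.act g⁻¹ v = v := by
  rw [map_inv, Equiv.Perm.inv_eq_iff_eq, h]

theorem sec_pow_of_fixed {g : G} {v : List A} (h : S.act g v = v) (n : ℕ) :
    S.sec (g ^ n) v = S.sec g v ^ n := by
  induction n with
  | zero => simp [sec_one]
  | succ n ih => rw [pow_succ, sec_mul, h, ih, pow_succ]

theorem sec_inv_of_fixed {g : G} {v : List A} (h : S.act g v = v) :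
    S.sec g⁻¹ v = (S.sec g v)⁻¹ := by
  have := S.sec_mul g⁻¹ g v
  rw [h, inv_mul_cancel, sec_one] at this
  exact eq_inv_of_mul_eq_one_left this.symm

/-- Sections at a given word are injective: they map each ball, a finite set, onto itself. -/
theorem sec_injective (v : List A) : Function.Injective (S.sec · v) := by
  intro g h hgh
  obtain ⟨n, hn⟩ := S.exists_mem_ball g
  obtain ⟨n', hn'⟩ := S.exists_mem_ball h
  have hinj : Set.InjOn (S.sec · v) (S.ball (max n n')) := by
    have hfin := S.finite_ball (max n n')
    refine (Set.ncard_image_iff hfin).1 ?_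
    rw [S.sec_image_ball]
  exact hinj (S.ball_mono (le_max_left _ _) hn) (S.ball_mono (le_max_right _ _) hn') hgh

/-- An injective self-map of a finite set has only periodic points. -/
theorem _root_.Set.Finite.exists_iterate_eq_self {α : Type*} {s : Set α} (hs : s.Finite)
    {f : α → α} (hf : Function.Injective f) (hmaps : Set.MapsTo f s s) {x : α} (hx : x ∈ s) :
    ∃ p, 0 < p ∧ f^[p] x = x := by
  obtain ⟨i, j, hij, h⟩ := hs.exists_lt_map_eq_of_forall_mem (f := fun n : ℕ => f^[n] x)
    fun n => hmaps.iterate n hx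
  refine ⟨j - i, by omega, hf.iterate i ?_⟩
  rw [← Function.iterate_add_apply, show i + (j - i) = j by omega]
  exact h.symm

/-- For some positive power of the word `v`, the section at that power fixes `g`. -/
theorem exists_sec_replicate_eq (g : G) (v : List A) :
    ∃ p, 0 < p ∧ S.sec g (List.replicate p v).flatten = g := by
  obtain ⟨n, hn⟩ := S.exists_mem_ball g
  obtain ⟨p, hp, h⟩ := (S.finite_ball n).exists_iterate_eq_self (S.sec_injective v)
    (fun x hx => S.sec_image_ball v n ▸ Set.mem_image_of_mem _ hx) hn
  refine ⟨p, hp, ?_⟩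
  have key (k : ℕ) (x : G) : S.sec x (List.replicate k v).flatten = (S.sec · v)^[k] x := by
    induction k generalizing x with
    | zero => simp [sec_nil]
    | succ k ih => rw [List.replicate_succ, List.flatten_cons, sec_append, ih,
        Function.iterate_succ_apply]
  rw [key, h]

variable [Finite A]

theorem finite_orbit (v : List A) : (Set.range fun g => S.act g v).Finite :=
  (List.finite_length_eq A v.length).subset <| by
    rintro _ ⟨g, rfl⟩
    exact S.length_act g v

theorem exists_act_pow_eq (g : G) (v : List A) : ∃ p, 0 < p ∧ S.act (g ^ p) v = v := by
  obtain ⟨p, hp, h⟩ := (List.finite_length_eq A v.length).exists_iterate_eq_self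
    (S.act g).injective (fun w hw => (S.length_act g w).trans hw) (x := v) rfl
  refine ⟨p, hp, ?_⟩
  rw [map_pow, ← Equiv.Perm.iterate_eq_pow, h]

end SectionAction

/-! ### Sections in `BS(1, m)` are affine conjugations -/

namespace BaumslagSolitar

open SectionAction

variable {m : ℕ} [NeZero m] {A : Type v} (S : SectionAction (BaumslagSolitar 1 m) A)

/-- The section at `v` is, on the stabilizer of `v`, conjugation by the affine map `z ↦ r z + φ`. -/
def IsConjugator (v : List A) (r φ : ℚ) : Prop :=
  r ≠ 0 ∧ ∀ h, S.act h v = v → slope (S.sec h v) = slope h ∧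
    shift (S.sec h v) = r * shift h + (1 - slope h) * φ

theorem IsConjugator.nil : IsConjugator S [] 1 0 :=
  ⟨one_ne_zero, fun h _ => by simp [sec_nil]⟩

variable {S} in
theorem IsConjugator.append {u v : List A} {r φ r' φ' : ℚ} (hu : IsConjugator S u r φ)
    (hv : IsConjugator S v r' φ') : IsConjugator S (u ++ v) (r' * r) (r' * φ + φ') := by
  refine ⟨mul_ne_zero hv.1 hu.1, fun h hh => ?_⟩
  rw [act_append] at hh
  obtain ⟨h1, h2⟩ := List.append_inj hh (S.length_act _ _)
  obtain ⟨h3, h4⟩ := hu.2 h h1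
  obtain ⟨h5, h6⟩ := hv.2 _ h2
  rw [sec_append]
  refine ⟨h5.trans h3, ?_⟩
  rw [h6, h4, h3]
  ring

/-- Elements of the affine group with positive slope have unique roots. -/
theorem eq_of_pow_eq {s s' x x' : ℚ} (hs : 0 < s) (hs' : 0 < s') {n : ℕ} (hn : n ≠ 0)
    (h1 : s ^ n = s' ^ n)
    (h2 : (∑ i ∈ Finset.range n, s ^ i) * x = (∑ i ∈ Finset.range n, s' ^ i) * x') :
    s = s' ∧ x = x' := by
  obtain rfl := (pow_left_inj₀ hs.le hs'.le hn).1 h1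
  have : 0 < ∑ i ∈ Finset.range n, s ^ i :=
    Finset.sum_pos (fun i _ => pow_pos hs i) (Finset.nonempty_range_iff.2 hn)
  exact ⟨rfl, mul_left_cancel₀ this.ne' h2⟩

/-- The section at `v` on the stabilizer of `v` is conjugation by an affine map: a power of `a`
and a power of `t` in the stabilizer determine the affine map.  The elements for which the formula
holds form a subgroup, which is closed under roots in the stabilizer because roots are unique among
the affine maps with positive slope; so it is the whole stabilizer. -/
theorem exists_isConjugator [Finite A] (hm : 2 ≤ m) (v : List A) :
    ∃ r φ, IsConjugator S v r φ := by
  have hmQ : (1 : ℚ) < m := by exact_mod_cast hm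
  obtain ⟨k, hk, hak⟩ := S.exists_act_pow_eq (genA m) v
  obtain ⟨j, hj, htj⟩ := S.exists_act_pow_eq (genT m) v
  set α := S.sec (genA m ^ k) v with hα
  set τ := S.sec (genT m ^ j) v with hτ
  have hmj : (1 : ℚ) < m ^ j := one_lt_pow₀ hmQ hj.ne'
  -- the relation `tʲ aᵏ = (aᵏ) ^ mʲ tʲ` passes to the sections
  have hrel : τ * α = α ^ (m ^ j) * τ := by
    have h : genT m ^ j * genA m ^ k = (genA m ^ k) ^ (m ^ j) * genT m ^ j := by
      rw [← pow_mul, mul_comm k]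
      exact_mod_cast genT_pow_mul_genA_zpow (m := m) j k
    have h' := congrArg (S.sec · v) h
    simpa only [sec_mul, hak, htj, S.sec_pow_of_fixed hak] using h'
  have hsα : slope α = 1 := by
    have h := congrArg slope hrel
    rw [slope_mul, slope_mul, mul_comm, slope_pow] at h
    have h' := mul_right_cancel₀ (slope_pos τ).ne' h
    have h1 : slope α ^ (m ^ j - 1) = 1 := by
      apply mul_right_cancel₀ (slope_pos α).ne'
      rw [pow_sub_one_mul (pow_ne_zero _ (NeZero.ne m)), one_mul, ← h']
    refine (pow_eq_one_iff_of_nonneg (slope_pos α).le ?_).1 h1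
    have : 1 < m ^ j := Nat.one_lt_pow hj.ne' hm
    omega
  have hxα : shift α ≠ 0 := fun h0 => by
    have h1 : α = 1 := ext_slope_shift hm (by rw [hsα, slope_one]) (by rw [h0, shift_one])
    have h2 : genA m ^ k = 1 := S.sec_injective v (by simp only [← hα, h1, sec_one])
    have h3 : genA m ^ (k : ℤ) = genA m ^ (0 : ℤ) := by rw [zpow_natCast, h2, zpow_zero]
    have := genA_zpow_injective h3
    omega
  have hsτ : slope τ = m ^ j := by
    have h := congrArg shift hrel
    rw [shift_mul, shift_mul, shift_pow, slope_pow, hsα] at h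
    simp only [one_pow, Finset.sum_const, Finset.card_range, nsmul_eq_mul, mul_one, one_mul,
      Nat.cast_pow] at h
    exact mul_right_cancel₀ hxα (by linarith)
  have hkQ : (k : ℚ) ≠ 0 := by exact_mod_cast hk.ne'
  set r := shift α / k with hr
  set φ := shift τ / (1 - m ^ j) with hφ
  have hrk : r * k = shift α := div_mul_cancel₀ _ hkQ
  have hφτ : (1 - (m : ℚ) ^ j) * φ = shift τ := mul_div_cancel₀ _ (by linarith)
  let good (h : BaumslagSolitar 1 m) : Prop := S.act h v = v ∧ slope (S.sec h v) = slope h ∧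
    shift (S.sec h v) = r * shift h + (1 - slope h) * φ
  have good_mul {g h} (hg : good g) (hh : good h) : good (g * h) := by
    obtain ⟨g1, g2, g3⟩ := hg
    obtain ⟨h1, h2, h3⟩ := hh
    refine ⟨by rw [act_mul, h1, g1], ?_, ?_⟩
    · rw [sec_mul, h1, slope_mul, slope_mul, g2, h2]
    · rw [sec_mul, h1, shift_mul, shift_mul, slope_mul, g2, g3, h3]
      ring
  have good_inv {g} (hg : good g) : good g⁻¹ := by
    obtain ⟨g1, g2, g3⟩ := hg
    have hinv (x : BaumslagSolitar 1 m) : shift x⁻¹ = - shift x / slope x := by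
      have h := shift_mul x x⁻¹
      rw [mul_inv_cancel, shift_one] at h
      rw [eq_div_iff (slope_pos x).ne']
      linarith
    refine ⟨S.act_inv_of_fixed g1, ?_, ?_⟩
    · rw [S.sec_inv_of_fixed g1, slope_inv, slope_inv, g2]
    · rw [S.sec_inv_of_fixed g1, hinv, hinv, slope_inv, g2, g3]
      have := (slope_pos g).ne'
      field_simp
      ring
  have good_npow {g} (hg : good g) (n : ℕ) : good (g ^ n) := by
    induction n with
    | zero => exact ⟨by simp, by simp [sec_one], by simp [sec_one]⟩
    | succ n ih => rw [pow_succ]; exact good_mul ih hg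
  have good_zpow {g} (hg : good g) (n : ℤ) : good (g ^ n) := by
    cases n with
    | ofNat n => simpa using good_npow hg n
    | negSucc n => rw [zpow_negSucc]; exact good_inv (good_npow hg _)
  have good_root {g} (h : S.act g v = v) {n : ℕ} (hn : n ≠ 0) (hg : good (g ^ n)) : good g := by
    obtain ⟨-, h2, h3⟩ := hg
    rw [S.sec_pow_of_fixed h] at h2 h3
    rw [slope_pow, slope_pow] at h2
    rw [shift_pow, shift_pow, slope_pow] at h3
    have hs := (pow_left_inj₀ (slope_pos _).le (slope_pos _).le hn).1 h2
    have hgeom : 1 - slope g ^ n = (∑ i ∈ Finset.range n, slope g ^ i) * (1 - slope g) := by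
      have := geom_sum_mul (slope g) n
      linarith
    refine ⟨h, eq_of_pow_eq (slope_pos _) (slope_pos _) hn h2 ?_⟩
    rw [h3, hgeom]
    ring
  have good_a : good (genA m ^ k) := by
    refine ⟨hak, ?_, ?_⟩
    · rw [← hα, hsα]
      exact_mod_cast (slope_genA_zpow (m := m) k).symm
    · have h1 := slope_genA_zpow (m := m) k
      have h2 := shift_genA_zpow (m := m) k
      rw [zpow_natCast] at h1 h2
      rw [← hα, h1, h2, Int.cast_natCast, hrk]
      ring
  have good_t : good (genT m ^ j) := by
    refine ⟨htj, ?_, ?_⟩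
    · rw [← hτ, hsτ, slope_genT_pow]
    · rw [← hτ, shift_genT_pow, slope_genT_pow, hφτ]
      ring
  -- a translation in the stabilizer has a power in `⟨aᵏ⟩`
  have good_translation {b} (h : S.act b v = v) (hb : slope b = 1) : good b := by
    have hden : (shift b).den * k ≠ 0 := Nat.mul_ne_zero (shift b).den_ne_zero hk.ne'
    refine good_root h hden ?_
    have : b ^ ((shift b).den * k) = (genA m ^ k) ^ (shift b).num := by
      rw [← zpow_natCast (genA m), ← zpow_mul]
      refine ext_slope_shift hm ?_ ?_
      · rw [slope_pow, hb, one_pow, slope_genA_zpow]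
      · rw [shift_pow, shift_genA_zpow, hb]
        have := Rat.den_mul_eq_num (shift b)
        simp only [one_pow, Finset.sum_const, Finset.card_range, nsmul_eq_mul, mul_one]
        push_cast
        linear_combination (k : ℚ) * this
    rw [this]
    exact good_zpow good_a _
  refine ⟨r, φ, div_ne_zero hxα hkQ, fun h hh => ?_⟩
  obtain ⟨e, he⟩ := exists_slope_eq_zpow h
  -- the `j`-th power of `h` is a power of `tʲ` times a translation
  have hte := good_zpow good_t e
  have hb : good (h ^ j * ((genT m ^ j) ^ e)⁻¹) := by
    refine good_translation ?_ ?_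
    · rw [act_mul, S.act_inv_of_fixed hte.1, S.act_pow_of_fixed hh]
    · rw [slope_mul, slope_inv, slope_zpow, slope_genT_pow, slope_pow, he, ← zpow_natCast,
        ← zpow_natCast, ← zpow_mul, ← zpow_mul, mul_comm, mul_comm (j : ℤ) e]
      exact inv_mul_cancel₀ (zpow_ne_zero _ (Nat.cast_ne_zero.2 (NeZero.ne m)))
  have := good_mul hb hte
  rw [inv_mul_cancel_right] at this
  exact (good_root hh hj.ne' this).2

/-- The element `g` intertwines the affine maps attached to `v` and to `g v`. -/
theorem IsConjugator.sec_eq [Finite A] (hm : 2 ≤ m) {v : List A} {r φ r' φ' : ℚ}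
    (g : BaumslagSolitar 1 m) (hv : IsConjugator S v r φ)
    (hgv : IsConjugator S (S.act g v) r' φ') :
    slope (S.sec g v) * r = r' * slope g ∧
      slope (S.sec g v) * φ + shift (S.sec g v) = r' * shift g + φ' := by
  have hmQ : (1 : ℚ) < m := by exact_mod_cast hm
  have key (h : BaumslagSolitar 1 m) (hh : S.act h v = v) :
      (slope h - 1) * shift (S.sec g v) + r' * (slope g * shift h + (1 - slope h) * shift g) +
        (1 - slope h) * φ' = slope (S.sec g v) * (r * shift h + (1 - slope h) * φ) := by
    obtain ⟨h1, h2⟩ := hv.2 h hh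
    have hfix : S.act (g * h * g⁻¹) (S.act g v) = S.act g v := by
      rw [← act_mul, inv_mul_cancel_right, act_mul, hh]
    obtain ⟨h3, h4⟩ := hgv.2 _ hfix
    have h5 : S.sec (g * h * g⁻¹) (S.act g v) * S.sec g v = S.sec g v * S.sec h v := by
      rw [← sec_mul, inv_mul_cancel_right, sec_mul, hh]
    have h6 : slope (g * h * g⁻¹) = slope h := by
      rw [slope_mul, slope_mul, slope_inv, mul_comm, inv_mul_cancel_left₀ (slope_pos g).ne']
    have h7 : shift (g * h * g⁻¹) = slope g * shift h + (1 - slope h) * shift g := by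
      have h := shift_mul (g * h * g⁻¹) g
      rw [inv_mul_cancel_right, h6, shift_mul] at h
      linarith
    have h8 := congrArg shift h5
    rw [shift_mul, shift_mul, h3, h4, h6, h7, h2] at h8
    linarith
  obtain ⟨k, hk, hak⟩ := S.exists_act_pow_eq (genA m) v
  obtain ⟨j, hj, htj⟩ := S.exists_act_pow_eq (genT m) v
  have h1 := key _ hak
  have h2 := key _ htj
  rw [← zpow_natCast, slope_genA_zpow, shift_genA_zpow, Int.cast_natCast] at h1
  rw [slope_genT_pow, shift_genT_pow] at h2
  have hkQ : (k : ℚ) ≠ 0 := by exact_mod_cast hk.ne'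
  have hmj : (1 : ℚ) - m ^ j ≠ 0 := by
    have : (1 : ℚ) < m ^ j := one_lt_pow₀ hmQ hj.ne'
    linarith
  constructor
  · exact mul_right_cancel₀ hkQ (by linarith)
  · exact mul_left_cancel₀ hmj (by linarith)

end BaumslagSolitar

/-! ### No action of `BS(1, m)` has bijective sections -/

namespace BaumslagSolitar

open SectionAction

variable {m : ℕ} [NeZero m] {A : Type v} (S : SectionAction (BaumslagSolitar 1 m) A)

/-- A choice of the affine maps `z ↦ r z + φ` attached to words that turns concatenation of words
into composition. -/
structure ConjugatorFamily where
  /-- the slopes -/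
  r : List A → ℚ
  /-- the constant terms -/
  φ : List A → ℚ
  isConjugator (v : List A) : IsConjugator S v (r v) (φ v)
  r_append (u v : List A) : r (u ++ v) = r v * r u
  φ_append (u v : List A) : φ (u ++ v) = r v * φ u + φ v

theorem nonempty_conjugatorFamily [Finite A] (hm : 2 ≤ m) : Nonempty (ConjugatorFamily S) := by
  choose ρ ψ h using fun a : A => exists_isConjugator S hm [a]
  let c (v : List A) : ℚ × ℚ := v.foldr (fun a p => (p.1 * ρ a, p.1 * ψ a + p.2)) (1, 0)
  refine ⟨⟨fun v => (c v).1, fun v => (c v).2, fun v => ?_, fun u v => ?_, fun u v => ?_⟩⟩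
  · induction v with
    | nil => exact IsConjugator.nil S
    | cons a v ih => exact (h a).append ih
  · induction u with
    | nil => simp [c]
    | cons a u ih =>
      change (c (u ++ v)).1 * ρ a = (c v).1 * ((c u).1 * ρ a)
      rw [ih, mul_assoc]
  · induction u with
    | nil => simp [c]
    | cons a u ih =>
      have hr : (c (u ++ v)).1 = (c v).1 * (c u).1 := by
        clear ih
        induction u with
        | nil => simp [c]
        | cons a u ih =>
          change (c (u ++ v)).1 * ρ a = (c v).1 * ((c u).1 * ρ a)
          rw [ih, mul_assoc]
      change (c (u ++ v)).1 * ψ a + (c (u ++ v)).2 = (c v).1 * ((c u).1 * ψ a + (c u).2) + (c v).2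
      rw [ih, hr]
      ring

namespace ConjugatorFamily

variable {S} [Finite A] (F : ConjugatorFamily S)

theorem slope_sec_mul (hm : 2 ≤ m) (g : BaumslagSolitar 1 m) (v : List A) :
    slope (S.sec g v) * F.r v = F.r (S.act g v) * slope g :=
  ((F.isConjugator v).sec_eq S hm g (F.isConjugator _)).1

/-- Sections do not change slopes.  At a word `v` with `|r|` maximal in its orbit, sections do not
increase slopes; but they permute each ball, so the sum of the slopes over the ball is unchanged.
Hence `|r|` is constant on orbits. -/
theorem slope_sec (F : ConjugatorFamily S) (hm : 2 ≤ m) (g : BaumslagSolitar 1 m) (v : List A) :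
    slope (S.sec g v) = slope g := by
  have habs (g v) : slope (S.sec g v) * |F.r v| = |F.r (S.act g v)| * slope g := by
    have := congrArg abs (F.slope_sec_mul hm g v)
    rwa [abs_mul, abs_mul, abs_of_pos (slope_pos _), abs_of_pos (slope_pos _)] at this
  have hpos (v) : 0 < |F.r v| := abs_pos.2 (F.isConjugator v).1
  obtain ⟨_, ⟨g₀, rfl⟩, hmax⟩ := Set.exists_max_image _ (fun w => |F.r w|) (S.finite_orbit v)
    ⟨_, 1, rfl⟩
  dsimp only at hmax
  set v₀ := S.act g₀ v with hv₀
  have hle (g) : |F.r (S.act g v₀)| ≤ |F.r v₀| :=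
    hmax _ ⟨g * g₀, by dsimp only; rw [act_mul]⟩
  have hslope (g) : slope (S.sec g v₀) ≤ slope g := by
    refine le_of_mul_le_mul_right ?_ (hpos v₀)
    rw [habs, mul_comm (slope g)]
    exact mul_le_mul_of_nonneg_right (hle g) (slope_pos g).le
  have heq (g) : slope (S.sec g v₀) = slope g := by
    obtain ⟨n, hn⟩ := S.exists_mem_ball g
    have hsum : ∑ x ∈ (S.finite_ball n).toFinset, slope (S.sec x v₀) =
        ∑ x ∈ (S.finite_ball n).toFinset, slope x := by
      classical
      rw [← Finset.sum_image (f := slope) (g := (S.sec · v₀)) (S.sec_injective v₀).injOn]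
      congr 1
      apply Finset.coe_injective
      simp [S.sec_image_ball]
    exact (Finset.sum_eq_sum_iff_of_le fun x _ => hslope x).1 hsum g (by simpa using hn)
  have hconst (g) : |F.r (S.act g v₀)| = |F.r v₀| := by
    have := habs g v₀
    rw [heq, mul_comm] at this
    exact (mul_right_cancel₀ (slope_pos g).ne' this).symm
  have horb (g) : |F.r (S.act g v)| = |F.r v₀| := by
    rw [← hconst (g * g₀⁻¹), hv₀, ← act_mul, inv_mul_cancel_right]
  have h := habs g v
  have h1 := horb 1
  rw [act_one] at h1
  rw [horb, h1, mul_comm] at h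
  exact mul_left_cancel₀ (h1 ▸ hpos v).ne' h

theorem r_act (hm : 2 ≤ m) (g : BaumslagSolitar 1 m) (v : List A) :
    F.r (S.act g v) = F.r v := by
  have := F.slope_sec_mul hm g v
  rw [F.slope_sec hm, mul_comm] at this
  exact (mul_right_cancel₀ (slope_pos g).ne' this).symm

theorem shift_sec (hm : 2 ≤ m) (g : BaumslagSolitar 1 m) (v : List A) :
    shift (S.sec g v) = F.r v * shift g + F.φ (S.act g v) - slope g * F.φ v := by
  have := ((F.isConjugator v).sec_eq S hm g (F.isConjugator _)).2
  rw [F.slope_sec hm, F.r_act hm] at this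
  linarith

/-- The slopes are `± 1`.  Sections at `v` permute the translations in a ball and multiply their
lengths by `|r|`, up to a bounded error; but the maximal length of a translation in a ball is
unbounded. -/
theorem abs_r (hm : 2 ≤ m) (v : List A) : |F.r v| = 1 := by
  obtain ⟨C, hC⟩ : ∃ C, ∀ g, |F.φ (S.act g v) - F.φ v| ≤ C := by
    obtain ⟨C, hC⟩ := ((S.finite_orbit v).image fun w => |F.φ w - F.φ v|).bddAbove
    exact ⟨C, fun g => hC ⟨_, ⟨g, rfl⟩, rfl⟩⟩
  have hshift (g) (hg : slope g = 1) :
      |shift (S.sec g v)| ≤ |F.r v| * |shift g| + C ∧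
      |F.r v| * |shift g| ≤ |shift (S.sec g v)| + C := by
    have h1 : shift (S.sec g v) = F.r v * shift g + (F.φ (S.act g v) - F.φ v) := by
      rw [F.shift_sec hm, hg]; ring
    have h2 : F.r v * shift g = shift (S.sec g v) - (F.φ (S.act g v) - F.φ v) := by
      rw [h1]; ring
    rw [← abs_mul]
    constructor
    · rw [h1]
      exact (abs_add_le _ _).trans (by gcongr; exact hC g)
    · rw [h2]
      exact (abs_sub _ _).trans (by gcongr; exact hC g)
  have hbig (N : ℕ) : ∃ M : ℚ, N ≤ M ∧ M ≤ |F.r v| * M + C ∧ |F.r v| * M ≤ M + C := by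
    obtain ⟨n, hn⟩ := S.exists_mem_ball (genA m ^ (N : ℤ))
    obtain ⟨b, ⟨hb, hsb⟩, hmax⟩ := Set.exists_max_image (S.ball n ∩ {g | slope g = 1})
      (fun g => |shift g|) ((S.finite_ball n).inter_of_left _) ⟨_, hn, slope_genA_zpow _⟩
    refine ⟨|shift b|, ?_, ?_, ?_⟩
    · have := hmax _ ⟨hn, slope_genA_zpow _⟩
      simpa only [shift_genA_zpow, Int.cast_natCast, Nat.abs_cast] using this
    · obtain ⟨g, hg, hgb⟩ : b ∈ (S.sec · v) '' S.ball n := by rwa [S.sec_image_ball]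
      have hsg : slope g = 1 := (F.slope_sec hm g v).symm.trans ((congrArg slope hgb).trans hsb)
      have h1 := (hshift g hsg).1
      have h2 : |shift g| ≤ |shift b| := hmax g ⟨hg, hsg⟩
      rw [show S.sec g v = b from hgb] at h1
      exact h1.trans (by gcongr)
    · have h1 := (hshift b hsb).2
      have h2 : |shift (S.sec b v)| ≤ |shift b| := hmax _
        ⟨S.sec_image_ball v n ▸ Set.mem_image_of_mem _ hb, (F.slope_sec hm b v).trans hsb⟩
      linarith
  rcases lt_trichotomy |F.r v| 1 with h | h | h
  · obtain ⟨N, hN⟩ := exists_nat_gt (C / (1 - |F.r v|))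
    obtain ⟨M, h1, h2, -⟩ := hbig N
    rw [div_lt_iff₀ (by linarith)] at hN
    nlinarith
  · exact h
  · obtain ⟨N, hN⟩ := exists_nat_gt (C / (|F.r v| - 1))
    obtain ⟨M, h1, -, h2⟩ := hbig N
    rw [div_lt_iff₀ (by linarith)] at hN
    nlinarith

theorem exists_abs_φ_le (hm : 2 ≤ m) : ∃ C : ℚ, ∀ v : List A, |F.φ v| ≤ C * v.length := by
  obtain ⟨C, hC⟩ := (Set.finite_range fun a : A => |F.φ [a]|).bddAbove
  have h0 : F.φ [] = 0 := by
    have h1 := F.φ_append [] []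
    have h2 := F.r_append [] []
    have h3 := (F.isConjugator []).1
    rw [List.append_nil] at h1 h2
    have : F.r [] = 1 := mul_left_cancel₀ h3 (by rw [← h2, mul_one])
    rw [this] at h1
    linarith
  refine ⟨C, fun v => ?_⟩
  induction v with
  | nil => simp [h0]
  | cons a v ih =>
    have h1 := F.φ_append [a] v
    have h2 : |F.φ [a]| ≤ C := hC ⟨a, rfl⟩
    rw [List.singleton_append] at h1
    rw [h1]
    refine (abs_add_le _ _).trans ?_
    rw [abs_mul, F.abs_r hm, List.length_cons]
    push_cast
    linarith

/-- If `r = 1` then `φ = 0`.  For a power `w` of `v` at which the section of `tⁿ` is `tⁿ`, the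
constant terms of `w` and `tⁿ w` differ by the factor `mⁿ`, whereas both are bounded by a multiple
of the length of `w`. -/
theorem φ_eq_zero (hm : 2 ≤ m) {v : List A} (hv : F.r v = 1) : F.φ v = 0 := by
  obtain ⟨C, hC⟩ := F.exists_abs_φ_le hm
  have hpow (p : ℕ) : F.φ (List.replicate (p + 1) v).flatten = (p + 1) * F.φ v ∧
      F.r (List.replicate (p + 1) v).flatten = 1 := by
    induction p with
    | zero => simp [hv]
    | succ p ih =>
      rw [List.replicate_succ, List.flatten_cons, F.φ_append, F.r_append, ih.1, ih.2, hv]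
      constructor
      · push_cast
        ring
      · norm_num
  have key (n : ℕ) : (m : ℚ) ^ n * |F.φ v| ≤ C * v.length := by
    obtain ⟨p, hp, h⟩ := S.exists_sec_replicate_eq (genT m ^ n) v
    obtain ⟨p, rfl⟩ := Nat.exists_eq_succ_of_ne_zero hp.ne'
    set w := (List.replicate (p + 1) v).flatten with hw
    have h1 := F.shift_sec hm (genT m ^ n) w
    rw [h, shift_genT_pow, slope_genT_pow, (hpow p).1] at h1
    have h2 := hC (S.act (genT m ^ n) w)
    have h3 : F.φ (S.act (genT m ^ n) w) = (p + 1) * (m ^ n * F.φ v) := by linarith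
    rw [S.length_act, h3, abs_mul, abs_mul, abs_of_pos (by positivity : (0 : ℚ) < p + 1),
      abs_of_nonneg (by positivity : (0 : ℚ) ≤ m ^ n)] at h2
    have hlen : (w.length : ℚ) = (p + 1) * v.length := by
      rw [hw, List.length_flatten]
      simp
    rw [hlen] at h2
    have hp' : (0 : ℚ) < p + 1 := by positivity
    exact le_of_mul_le_mul_left (by linarith) hp'
  by_contra hne
  have hpos : 0 < |F.φ v| := abs_pos.2 hne
  obtain ⟨n, hn⟩ := pow_unbounded_of_one_lt (C * v.length / |F.φ v|)
    (by exact_mod_cast hm : (1 : ℚ) < m)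
  rw [div_lt_iff₀ hpos] at hn
  exact (key n).not_gt hn

theorem φ_eq_of_r_eq (hm : 2 ≤ m) {u v : List A} (h : F.r u = F.r v) : F.φ u = F.φ v := by
  rcases eq_or_eq_neg_of_abs_eq (F.abs_r hm v) with hv | hv
  · rw [F.φ_eq_zero hm (h.trans hv), F.φ_eq_zero hm hv]
  · have h1 := F.φ_eq_zero hm (v := u ++ v) (by rw [F.r_append, h, hv]; norm_num)
    rw [F.φ_append, hv] at h1
    linarith

theorem sec_eq_of_r_eq (hm : 2 ≤ m) {u v : List A} (h : F.r u = F.r v)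
    (g : BaumslagSolitar 1 m) : S.sec g u = S.sec g v := by
  refine ext_slope_shift hm (by rw [F.slope_sec hm, F.slope_sec hm]) ?_
  have h1 : F.φ (S.act g u) = F.φ (S.act g v) :=
    F.φ_eq_of_r_eq hm (by rw [F.r_act hm, F.r_act hm, h])
  rw [F.shift_sec hm, F.shift_sec hm, h, h1, F.φ_eq_of_r_eq hm h]

end ConjugatorFamily

/-- An action with bijective sections does not exist: every element would have at most two
different sections, and so be determined by the action of these two on the one-letter words. -/
theorem isEmpty_sectionAction [Finite A] (hm : 2 ≤ m) :
    IsEmpty (SectionAction (BaumslagSolitar 1 m) A) := by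
  refine ⟨fun S => ?_⟩
  obtain ⟨F⟩ := nonempty_conjugatorFamily S hm
  -- words `u ε` that realize the possible values of `r`
  obtain ⟨u, hu⟩ : ∃ u : Bool → List A, ∀ v, ∃ ε, F.r v = F.r (u ε) := by
    have hr (v) : F.r v = 1 ∨ F.r v = -1 := eq_or_eq_neg_of_abs_eq (F.abs_r hm v)
    by_cases h : ∃ w₁ w₂, F.r w₁ = 1 ∧ F.r w₂ = -1
    · obtain ⟨w₁, w₂, h₁, h₂⟩ := h
      exact ⟨fun ε => cond ε w₁ w₂, fun v => (hr v).elim (fun hv => ⟨true, hv.trans h₁.symm⟩)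
        fun hv => ⟨false, hv.trans h₂.symm⟩⟩
    · push Not at h
      refine ⟨fun _ => [], fun v => ⟨true, ?_⟩⟩
      rcases hr v with hv | hv <;> rcases hr [] with h0 | h0
      · rw [hv, h0]
      · exact absurd h0 (h _ _ hv)
      · exact absurd hv (h _ _ h0)
      · rw [hv, h0]
  let f (g : BaumslagSolitar 1 m) : Bool × A → {w : List A // w.length = 1} :=
    fun p => ⟨S.act (S.sec g (u p.1)) [p.2], S.length_act _ _⟩
  have hf : Function.Injective f := fun g h hgh => by
    refine S.act_injective (Equiv.ext fun v => ?_)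
    induction v using List.reverseRecOn with
    | nil => rw [act_nil, act_nil]
    | append_singleton v a ih =>
      obtain ⟨ε, hε⟩ := hu v
      have h1 : S.act (S.sec g (u ε)) [a] = S.act (S.sec h (u ε)) [a] :=
        congrArg Subtype.val (congrFun hgh (ε, a))
      rw [act_append, act_append, ih, F.sec_eq_of_r_eq hm hε, F.sec_eq_of_r_eq hm hε, h1]
  have : Finite {w : List A // w.length = 1} := List.finite_length_eq A 1
  have : Finite (BaumslagSolitar 1 m) := Finite.of_injective f hf
  exact not_injective_infinite_finite _ (genA_zpow_injective (m := m))

theorem not_isBireversibleGroup {m : ℕ} (hm : 2 ≤ m) :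
    ¬ IsBireversibleGroup (BaumslagSolitar 1 m) := by
  have : NeZero m := ⟨by omega⟩
  rintro ⟨A, Q, M, hM, ⟨e⟩⟩
  have := M.finite_alphabet
  obtain ⟨S⟩ := hM.nonempty_sectionAction M e
  exact (isEmpty_sectionAction hm).false S

end BaumslagSolitar

/-! ### Bireversible and reversible automaton groups -/

theorem corollaryE :
    Bir.{u} ⊂ InvRev.{u} ∧
    ∀ m : ℕ, 2 ≤ m →
      IsInvertibleReversibleGroup (BaumslagSolitar 1 m) ∧
      (∃ g : BaumslagSolitar 1 m, (Subgroup.zpowers g).IsDistorted) ∧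
      ¬ IsBireversibleGroup (BaumslagSolitar 1 m) := by
  refine ⟨⟨fun G => ?_, fun h => ?_⟩, fun m hm =>
    ⟨BaumslagSolitar.isInvertibleReversibleGroup hm,
      ⟨_, BaumslagSolitar.zpowers_genA_isDistorted hm⟩,
      BaumslagSolitar.not_isBireversibleGroup hm⟩⟩
  · rintro ⟨A, Q, M, hM, e⟩
    exact ⟨A, Q, M, ⟨hM.1, hM.2.1⟩, e⟩
  · -- `BS(1, 2)`, lifted to the universe `u`, is in the larger class only
    obtain ⟨A, Q, M, hM, ⟨e⟩⟩ :=
      BaumslagSolitar.isInvertibleReversibleGroup (m := 2) le_rfl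
    have hG : GrpCat.of (ULift.{u} (BaumslagSolitar 1 (2 : ℕ))) ∈ InvRev.{u} :=
      ⟨A, Q, M, hM, ⟨MulEquiv.ulift.trans e⟩⟩
    obtain ⟨A', Q', M', hM', ⟨e'⟩⟩ := h hG
    exact BaumslagSolitar.not_isBireversibleGroup (m := 2) le_rfl
      ⟨A', Q', M', hM', ⟨MulEquiv.ulift.symm.trans e'⟩⟩
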